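/- **Proposition (Weyl tensor of a static spacetime).** Let $(M,g)$ be a smooth four-dimensional Lorentzian manifold of signature $(-,+,+,+)$ which is static, i.e. it carries a smooth vector field $u$ (the velocity) with $$u^ku_k=-1,\qquad \nabla_j u_k=-u_j\dot u_k,\qquad \nabla_j\dot u_k=\nabla_k\dot u_j,\qquad\text{where } \dot u_k=u^j\nabla_ju_k .$$ Let the Riemann tensor be normalized by $(\nabla_j\nabla_k-\nabla_k\nabla_j)\omega_l=R_{jkl}{}^m\omega_m$ for covector fields $\omega$, let $R_{km}=g^{jl}R_{jklm}$ and $R=g^{jk}R_{jk}$, let $$C_{jklm}=R_{jklm}+\tfrac12\left(g_{jm}R_{kl}-g_{km}R_{jl}+g_{kl}R_{jm}-g_{jl}R_{km}\right)-\tfrac R6\left(g_{jm}g_{kl}-g_{km}g_{jl}\right)$$ be the Weyl tensor, and let $E_{kl}=u^jC_{jklm}u^m$ be the electric tensor. Then the Weyl tensor is determined by the electric tensor: at every point and in every smooth coordinate chart, $$C_{jklm}=(g_{kl}+2u_ku_l)E_{jm}-(g_{jl}+2u_ju_l)E_{km}+(g_{jm}+2u_ju_m)E_{kl}-(g_{km}+2u_ku_m)E_{jl},$$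 and $$C_{jklm}C^{jklm}=8\,E^{kl}E_{kl}.$$ -/

import Mathlib

open scoped Manifold ContDiff

noncomputable section

namespace StaticSpacetime

/-- The model space `ℝ⁴`, with coordinates `y i`, `i : Fin 4`. -/
abbrev E4 : Type := EuclideanSpace ℝ (Fin 4)

/-- The standard manifold structure of `ℝ⁴`, restated so that instance search finds it first. -/
instance chartedSpaceE4 : ChartedSpace E4 E4 := chartedSpaceSelf E4

/-! ### Tensor calculus in a coordinate domain

`G : E4 → Matrix (Fin 4) (Fin 4) ℝ` is the matrix `g_{ij}` of metric components. -/

/-- The partial derivative `∂_i f` at `y`. -/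
def pd (i : Fin 4) (f : E4 → ℝ) (y : E4) : ℝ :=
  fderiv ℝ f y (EuclideanSpace.single i 1)

/-- The components `g^{ij}` of the inverse metric. -/
def ginv (G : E4 → Matrix (Fin 4) (Fin 4) ℝ) (y : E4) (i j : Fin 4) : ℝ :=
  (G y)⁻¹ i j

/-- Christoffel symbols of the Levi-Civita connection:
`chr G m j k = Γ^m_{jk} = ½ g^{ml} (∂_j g_{kl} + ∂_k g_{jl} - ∂_l g_{jk})`. -/
def chr (G : E4 → Matrix (Fin 4) (Fin 4) ℝ) (m j k : Fin 4) (y : E4) : ℝ :=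
  (1 / 2) * ∑ l, ginv G y m l *
    (pd j (fun z => G z k l) y + pd k (fun z => G z j l) y - pd l (fun z => G z j k) y)

/-- Covariant derivative of a covector field: `∇_j w_k = ∂_j w_k - Γ^m_{jk} w_m`. -/
def nabla (G : E4 → Matrix (Fin 4) (Fin 4) ℝ) (w : Fin 4 → E4 → ℝ) (j k : Fin 4) (y : E4) : ℝ :=
  pd j (w k) y - ∑ m, chr G m j k y * w m y

/-- The curvature `R_{jkl}{}^m`, normalized by
`(∇_j ∇_k - ∇_k ∇_j) w_l = R_{jkl}{}^m w_m`. -/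
def riemUp (G : E4 → Matrix (Fin 4) (Fin 4) ℝ) (j k l m : Fin 4) (y : E4) : ℝ :=
  pd k (chr G m j l) y - pd j (chr G m k l) y
    + ∑ p, (chr G p j l y * chr G m k p y - chr G p k l y * chr G m j p y)

/-- The Riemann tensor `R_{jklm} = R_{jkl}{}^p g_{pm}`. -/
def riem (G : E4 → Matrix (Fin 4) (Fin 4) ℝ) (j k l m : Fin 4) (y : E4) : ℝ :=
  ∑ p, riemUp G j k l p y * G y p m

/-- The Ricci tensor `R_{km} = g^{jl} R_{jklm}`. -/
def ricci (G : E4 → Matrix (Fin 4) (Fin 4) ℝ) (k m : Fin 4) (y : E4) : ℝ :=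
  ∑ j, ∑ l, ginv G y j l * riem G j k l m y

/-- The scalar curvature `R = g^{jk} R_{jk}`. -/
def scal (G : E4 → Matrix (Fin 4) (Fin 4) ℝ) (y : E4) : ℝ :=
  ∑ j, ∑ k, ginv G y j k * ricci G j k y

/-- The Weyl tensor `C_{jklm}` in dimension four. -/
def weyl (G : E4 → Matrix (Fin 4) (Fin 4) ℝ) (j k l m : Fin 4) (y : E4) : ℝ :=
  riem G j k l m y
    + (1 / 2) * (G y j m * ricci G k l y - G y k m * ricci G j l y
        + G y k l * ricci G j m y - G y j l * ricci G k m y)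
    - (scal G y / 6) * (G y j m * G y k l - G y k m * G y j l)

/-- Raising the four indices: `C^{jklm}`. -/
def weylRaised (G : E4 → Matrix (Fin 4) (Fin 4) ℝ) (j k l m : Fin 4) (y : E4) : ℝ :=
  ∑ a, ∑ b, ∑ c, ∑ d,
    ginv G y j a * ginv G y k b * ginv G y l c * ginv G y m d * weyl G a b c d y

/-- Lowering the index of a vector field: `v_k = g_{kl} v^l`. -/
def lower (G : E4 → Matrix (Fin 4) (Fin 4) ℝ) (v : Fin 4 → E4 → ℝ) (k : Fin 4) (y : E4) : ℝ :=
  ∑ l, G y k l * v l y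

/-- The acceleration `u̇_k = u^j ∇_j u_k`, for `v j = u^j`. -/
def acc (G : E4 → Matrix (Fin 4) (Fin 4) ℝ) (v : Fin 4 → E4 → ℝ) (k : Fin 4) (y : E4) : ℝ :=
  ∑ j, v j y * nabla G (lower G v) j k y

/-- The electric tensor `E_{kl} = u^j C_{jklm} u^m`, for `v j = u^j`. -/
def elec (G : E4 → Matrix (Fin 4) (Fin 4) ℝ) (v : Fin 4 → E4 → ℝ) (k l : Fin 4) (y : E4) : ℝ :=
  ∑ j, ∑ m, v j y * weyl G j k l m y * v m y

/-- Raising both indices: `E^{kl}`. -/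
def elecRaised (G : E4 → Matrix (Fin 4) (Fin 4) ℝ) (v : Fin 4 → E4 → ℝ) (k l : Fin 4)
    (y : E4) : ℝ :=
  ∑ a, ∑ b, ginv G y k a * ginv G y l b * elec G v a b y

/-! ### Lorentzian manifolds -/

/-- A smooth Lorentzian metric, of signature `(-,+,+,+)`, on a four-dimensional manifold. -/
structure LorentzianMetric (M : Type*) [TopologicalSpace M] [ChartedSpace E4 M]
    [IsManifold (𝓡 4) ∞ M] where
  /-- The scalar product on each tangent space. -/
  inner (p : M) : TangentSpace (𝓡 4) p →L[ℝ] TangentSpace (𝓡 4) p →L[ℝ] ℝ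
  symm (p : M) (v w : TangentSpace (𝓡 4) p) : inner p v w = inner p w v
  signature (p : M) : ∃ b : Module.Basis (Fin 4) ℝ (TangentSpace (𝓡 4) p), ∀ i j : Fin 4,
    inner p (b i) (b j) = if i = j then (if i = 0 then -1 else 1) else 0
  contMDiff : ContMDiff (𝓡 4) ((𝓡 4).prod 𝓘(ℝ, E4 →L[ℝ] E4 →L[ℝ] ℝ)) ∞
    (fun p => Bundle.TotalSpace.mk' (E4 →L[ℝ] E4 →L[ℝ] ℝ)
      (E := fun p : M => TangentSpace (𝓡 4) p →L[ℝ] TangentSpace (𝓡 4) p →L[ℝ] ℝ) p (inner p))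

variable {M : Type*} [TopologicalSpace M] [ChartedSpace E4 M]

/-- The coordinate vector `∂_i` of the chart `e` at the point with coordinates `y`. -/
def coordVec (e : OpenPartialHomeomorph M E4) (i : Fin 4) (y : E4) :
    TangentSpace (𝓡 4) (e.symm y) :=
  mfderiv (𝓡 4) (𝓡 4) e.symm y (EuclideanSpace.single i (1 : ℝ) : E4)

/-- The metric components `g_{ij} = g(∂_i, ∂_j)` in the chart `e`,
as functions of the coordinates. -/
def LorentzianMetric.comp [IsManifold (𝓡 4) ∞ M] (g : LorentzianMetric M)
    (e : OpenPartialHomeomorph M E4) (y : E4) : Matrix (Fin 4) (Fin 4) ℝ :=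
  Matrix.of fun i j => g.inner (e.symm y) (coordVec e i y) (coordVec e j y)

/-- The components `u^i = dx^i(u)` of a vector field in the chart `e`,
as functions of the coordinates. -/
def vecComp (u : ∀ p : M, TangentSpace (𝓡 4) p) (e : OpenPartialHomeomorph M E4)
    (i : Fin 4) (y : E4) : ℝ :=
  (EuclideanSpace.proj i : E4 →L[ℝ] ℝ) (mfderiv (𝓡 4) (𝓡 4) e (e.symm y) (u (e.symm y)))

/-- `u` is the velocity field of a static spacetime: a smooth vector field with
`u^k u_k = -1`, `∇_j u_k = -u_j u̇_k` and `∇_j u̇_k = ∇_k u̇_j`. The last two are equations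
between tensors, written in components in every smooth chart. -/
structure IsStaticVelocity [IsManifold (𝓡 4) ∞ M] (g : LorentzianMetric M)
    (u : ∀ p : M, TangentSpace (𝓡 4) p) : Prop where
  contMDiff : ContMDiff (𝓡 4) (𝓡 4).tangent ∞ (fun p => (⟨p, u p⟩ : TangentBundle (𝓡 4) M))
  normalized : ∀ p : M, g.inner p (u p) (u p) = -1
  nabla_velocity : ∀ e ∈ IsManifold.maximalAtlas (𝓡 4) ∞ M, ∀ y ∈ e.target, ∀ j k : Fin 4,
    nabla (g.comp e) (lower (g.comp e) (vecComp u e)) j k y =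
      -(lower (g.comp e) (vecComp u e) j y * acc (g.comp e) (vecComp u e) k y)
  closed_acc : ∀ e ∈ IsManifold.maximalAtlas (𝓡 4) ∞ M, ∀ y ∈ e.target, ∀ j k : Fin 4,
    nabla (g.comp e) (acc (g.comp e) (vecComp u e)) j k y =
      nabla (g.comp e) (acc (g.comp e) (vecComp u e)) k j y

end StaticSpacetime

end

namespace StaticSpacetime

section Chart

variable {M : Type*} [TopologicalSpace M] [ChartedSpace E4 M] [IsManifold (𝓡 4) ∞ M]
  {e : OpenPartialHomeomorph M E4}

omit [IsManifold (𝓡 4) ∞ M] in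
theorem mdifferentiable_of_mem_maximalAtlas (he : e ∈ IsManifold.maximalAtlas (𝓡 4) ∞ M) :
    e.MDifferentiable (𝓡 4) (𝓡 4) :=
  ⟨(contMDiffOn_of_mem_maximalAtlas he).mdifferentiableOn (by simp),
    (contMDiffOn_symm_of_mem_maximalAtlas he).mdifferentiableOn (by simp)⟩

/-- The coordinate vectors of a chart depend smoothly on the coordinates. -/
theorem contMDiffOn_coordVec (he : e ∈ IsManifold.maximalAtlas (𝓡 4) ∞ M) (i : Fin 4) :
    ContMDiffOn (𝓡 4) (𝓡 4).tangent ∞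
      (fun y => (⟨e.symm y, coordVec e i y⟩ : TangentBundle (𝓡 4) M)) e.target := by
  have hs : UniqueMDiffOn (𝓡 4) e.target := e.open_target.uniqueMDiffOn
  have h1 := (contMDiffOn_symm_of_mem_maximalAtlas he).contMDiffOn_tangentMapWithin
    (m := ∞) (by simp) hs
  have h2 : ContMDiffOn (𝓡 4) (𝓡 4).tangent ∞
      (fun y : E4 => (⟨y, (EuclideanSpace.single i (1 : ℝ) : E4)⟩ : TangentBundle (𝓡 4) E4))
      e.target := fun y _ =>
    contMDiffWithinAt_vectorSpace_iff_contDiffWithinAt.2 contDiffWithinAt_const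
  refine (h1.comp h2 fun y hy => hy).congr fun y hy => ?_
  simp only [Function.comp, tangentMapWithin, coordVec]
  rw [mfderivWithin_of_isOpen e.open_target hy]

/-- The metric components are smooth functions of the coordinates. -/
theorem LorentzianMetric.contDiffOn_comp (g : LorentzianMetric M)
    (he : e ∈ IsManifold.maximalAtlas (𝓡 4) ∞ M) (i j : Fin 4) :
    ContDiffOn ℝ ∞ (fun y => g.comp e y i j) e.target := by
  intro y hy
  have h : ContMDiffWithinAt (𝓡 4) ((𝓡 4).prod 𝓘(ℝ)) ∞
      (fun y ↦ Bundle.TotalSpace.mk' ℝ (E := Bundle.Trivial M ℝ) (e.symm y)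
        (g.inner (e.symm y) (coordVec e i y) (coordVec e j y))) e.target y := by
    apply ContMDiffWithinAt.clm_bundle_apply₂ (F₁ := E4) (F₂ := E4)
      (E₁ := fun p : M => TangentSpace (𝓡 4) p) (E₂ := fun p : M => TangentSpace (𝓡 4) p)
    · exact ContMDiffAt.comp_contMDiffWithinAt y g.contMDiff.contMDiffAt
        (contMDiffOn_symm_of_mem_maximalAtlas he y hy)
    · exact contMDiffOn_coordVec he i y hy
    · exact contMDiffOn_coordVec he j y hy
  rw [Bundle.contMDiffWithinAt_totalSpace] at h
  exact h.2.contDiffWithinAt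

/-- The components of a smooth vector field are smooth functions of the coordinates. -/
theorem contDiffOn_vecComp {u : ∀ p : M, TangentSpace (𝓡 4) p}
    (hu : ContMDiff (𝓡 4) (𝓡 4).tangent ∞ (fun p => (⟨p, u p⟩ : TangentBundle (𝓡 4) M)))
    (he : e ∈ IsManifold.maximalAtlas (𝓡 4) ∞ M) (i : Fin 4) :
    ContDiffOn ℝ ∞ (vecComp u e i) e.target := by
  have hs : UniqueMDiffOn (𝓡 4) e.source := e.open_source.uniqueMDiffOn
  have h1 := (contMDiffOn_of_mem_maximalAtlas he).contMDiffOn_tangentMapWithin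
    (m := ∞) (by simp) hs
  have h2 := hu.comp_contMDiffOn (contMDiffOn_symm_of_mem_maximalAtlas he)
  have h3 := (contMDiff_snd_tangentBundle_modelSpace E4 (𝓡 4) (n := ∞)).comp_contMDiffOn
    (h1.comp h2 fun y hy => e.map_target hy)
  have h4 := (EuclideanSpace.proj i : E4 →L[ℝ] ℝ).contDiff.comp_contDiffOn (n := ∞) h3.contDiffOn
  refine h4.congr fun y hy => ?_
  simp only [Function.comp, tangentMapWithin, vecComp]
  rw [mfderivWithin_of_isOpen e.open_source (e.map_target hy)]

theorem LorentzianMetric.comp_symm (g : LorentzianMetric M) (e : OpenPartialHomeomorph M E4)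
    (y : E4) (i j : Fin 4) : g.comp e y i j = g.comp e y j i :=
  g.symm _ _ _

theorem LorentzianMetric.eq_zero_of_inner_eq_zero (g : LorentzianMetric M) (p : M)
    (w : TangentSpace (𝓡 4) p) (h : ∀ x, g.inner p x w = 0) : w = 0 := by
  obtain ⟨b, hb⟩ := g.signature p
  rw [← b.sum_repr w]
  refine Finset.sum_eq_zero fun i _ => ?_
  have := h (b i)
  rw [← b.sum_repr w] at this
  simp only [map_sum, map_smul, hb, smul_eq_mul, mul_ite, mul_zero, Finset.sum_ite_eq,
    Finset.mem_univ, if_true] at this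
  split_ifs at this <;> simp_all

omit [IsManifold (𝓡 4) ∞ M] in
theorem sum_smul_coordVec (e : OpenPartialHomeomorph M E4) (y x : E4) :
    ∑ i, x i • coordVec e i y = mfderiv (𝓡 4) (𝓡 4) e.symm y x := by
  have hx : x = ∑ i, x i • (EuclideanSpace.single i (1 : ℝ) : E4) := by
    have := (EuclideanSpace.basisFun (Fin 4) ℝ).sum_repr x
    simpa using this.symm
  conv_rhs => rw [hx]
  erw [map_sum]
  refine Finset.sum_congr rfl fun i _ => ?_
  erw [map_smul]
  rfl

theorem LorentzianMetric.det_comp_ne_zero (g : LorentzianMetric M)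
    (he : e ∈ IsManifold.maximalAtlas (𝓡 4) ∞ M) {y : E4} (hy : y ∈ e.target) :
    (g.comp e y).det ≠ 0 := by
  intro h
  obtain ⟨x, hx0, hx⟩ := Matrix.exists_mulVec_eq_zero_iff.2 h
  apply hx0
  have hd := mdifferentiable_of_mem_maximalAtlas he
  set X : TangentSpace (𝓡 4) (e.symm y) :=
    mfderiv (𝓡 4) (𝓡 4) e.symm y (WithLp.toLp 2 x : E4) with hX
  have h0 : X = 0 := by
    refine g.eq_zero_of_inner_eq_zero _ _ fun w => ?_
    obtain ⟨z, rfl⟩ := hd.symm.mfderiv_surjective (x := y) hy w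
    have hz := sum_smul_coordVec e y z
    rw [g.symm, hX, ← hz, ← sum_smul_coordVec e y]
    simp only [map_sum, map_smul, sum_apply, smul_apply]
    refine Finset.sum_eq_zero fun i _ => ?_
    have := congrFun hx i
    simp only [Matrix.mulVec, dotProduct, LorentzianMetric.comp, Matrix.of_apply,
      Pi.zero_apply] at this
    simp only [smul_eq_mul]
    have h2 : ∑ j, x j * g.inner (e.symm y) (coordVec e j y) (coordVec e i y) = 0 := by
      rw [← this]
      exact Finset.sum_congr rfl fun j _ => by rw [g.symm, mul_comm]
    rw [h2, mul_zero]
  have h1 := hd.symm.mfderiv_injective (x := y) hy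
  have h2 : (WithLp.toLp 2 x : E4) = 0 := h1 (h0.trans (map_zero _).symm)
  exact (WithLp.toLp_eq_zero 2).1 h2

theorem LorentzianMetric.sum_comp_vecComp (g : LorentzianMetric M)
    (he : e ∈ IsManifold.maximalAtlas (𝓡 4) ∞ M) (u : ∀ p : M, TangentSpace (𝓡 4) p)
    {y : E4} (hy : y ∈ e.target) :
    ∑ i, ∑ j, g.comp e y i j * vecComp u e i y * vecComp u e j y =
      g.inner (e.symm y) (u (e.symm y)) (u (e.symm y)) := by
  have hd := mdifferentiable_of_mem_maximalAtlas he
  have hu : ∑ i, vecComp u e i y • coordVec e i y = u (e.symm y) := by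
    have h := hd.symm_comp_deriv (e.map_target hy)
    have h1 := sum_smul_coordVec e y (mfderiv (𝓡 4) (𝓡 4) e (e.symm y) (u (e.symm y)))
    rw [e.right_inv hy] at h
    exact h1.trans (DFunLike.congr_fun h (u (e.symm y)))
  conv_rhs => rw [← hu]
  simp only [map_sum, map_smul, sum_apply, smul_apply,
    smul_eq_mul, Finset.mul_sum]
  refine Finset.sum_congr rfl fun i _ => Finset.sum_congr rfl fun j _ => ?_
  simp only [LorentzianMetric.comp, Matrix.of_apply]
  rw [g.symm]
  ring

end Chart

section Coordinates

variable {U : Set E4} {y : E4} {f h : E4 → ℝ}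

theorem contDiffOn_pd (hU : IsOpen U) (hf : ContDiffOn ℝ ∞ f U) (i : Fin 4) :
    ContDiffOn ℝ ∞ (pd i f) U :=
  (hf.fderiv_of_isOpen hU (m := ∞) (by simp)).clm_apply contDiffOn_const

theorem differentiableAt_of_contDiffOn (hU : IsOpen U) (hf : ContDiffOn ℝ ∞ f U) (hy : y ∈ U) :
    DifferentiableAt ℝ f y :=
  (hf.contDiffAt (hU.mem_nhds hy)).differentiableAt (by simp)

theorem pd_congr (hU : IsOpen U) (hy : y ∈ U) (hfh : ∀ z ∈ U, f z = h z) (i : Fin 4) :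
    pd i f y = pd i h y := by
  have : f =ᶠ[nhds y] h := Filter.mem_of_superset (hU.mem_nhds hy) hfh
  rw [pd, pd, this.fderiv_eq]

theorem pd_add (hf : DifferentiableAt ℝ f y) (hh : DifferentiableAt ℝ h y) (i : Fin 4) :
    pd i (fun z => f z + h z) y = pd i f y + pd i h y := by
  simp [pd, fderiv_fun_add hf hh]

theorem pd_sub (hf : DifferentiableAt ℝ f y) (hh : DifferentiableAt ℝ h y) (i : Fin 4) :
    pd i (fun z => f z - h z) y = pd i f y - pd i h y := by
  simp [pd, fderiv_fun_sub hf hh]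

theorem pd_mul (hf : DifferentiableAt ℝ f y) (hh : DifferentiableAt ℝ h y) (i : Fin 4) :
    pd i (fun z => f z * h z) y = pd i f y * h y + f y * pd i h y := by
  simp [pd, fderiv_fun_mul hf hh]
  ring

theorem pd_sum {F : Fin 4 → E4 → ℝ} (hF : ∀ p, DifferentiableAt ℝ (F p) y) (i : Fin 4) :
    pd i (fun z => ∑ p, F p z) y = ∑ p, pd i (F p) y := by
  simp [pd, fderiv_fun_sum fun p _ => hF p]

theorem pd_comm (hU : IsOpen U) (hf : ContDiffOn ℝ ∞ f U) (hy : y ∈ U) (i j : Fin 4) :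
    pd i (pd j f) y = pd j (pd i f) y := by
  have hd : DifferentiableAt ℝ (fderiv ℝ f) y :=
    ((hf.fderiv_of_isOpen hU (m := ∞) (by simp)).contDiffAt (hU.mem_nhds hy)).differentiableAt
      (by simp)
  have key : ∀ a b : Fin 4, pd a (pd b f) y =
      fderiv ℝ (fderiv ℝ f) y (EuclideanSpace.single a 1) (EuclideanSpace.single b 1) := by
    intro a b
    rw [pd]
    have : (pd b f) = fun z => fderiv ℝ f z (EuclideanSpace.single b 1) := rfl
    rw [this, fderiv_clm_apply hd (differentiableAt_const _)]
    simp
  rw [key, key]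
  have hs : IsSymmSndFDerivAt ℝ f y :=
    (hf.contDiffAt (hU.mem_nhds hy)).isSymmSndFDerivAt (by simpa using ENat.LEInfty.out)
  exact hs.eq _ _

theorem contDiffOn_det {G : E4 → Matrix (Fin 4) (Fin 4) ℝ}
    (hG : ∀ i j, ContDiffOn ℝ ∞ (fun z => G z i j) U) :
    ContDiffOn ℝ ∞ (fun z => (G z).det) U := by
  simp only [Matrix.det_apply]
  exact ContDiffOn.sum fun σ _ => (contDiffOn_prod fun i _ => hG _ _).const_smul _

variable {G : E4 → Matrix (Fin 4) (Fin 4) ℝ}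

theorem contDiffOn_ginv (hG : ∀ i j, ContDiffOn ℝ ∞ (fun z => G z i j) U)
    (hdet : ∀ z ∈ U, (G z).det ≠ 0) (i j : Fin 4) :
    ContDiffOn ℝ ∞ (fun z => ginv G z i j) U := by
  have : ∀ z, ginv G z i j = (G z).det⁻¹ * ((G z).updateRow j (Pi.single i 1)).det := by
    intro z
    simp [ginv, Matrix.inv_def, Matrix.adjugate_apply]
  simp only [this]
  refine ((contDiffOn_det hG).inv hdet).mul (contDiffOn_det fun a b => ?_)
  by_cases ha : a = j
  · subst ha
    simpa using contDiffOn_const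
  · simpa [Matrix.updateRow_apply, ha] using hG a b

theorem contDiffOn_chr (hU : IsOpen U) (hG : ∀ i j, ContDiffOn ℝ ∞ (fun z => G z i j) U)
    (hdet : ∀ z ∈ U, (G z).det ≠ 0) (m j k : Fin 4) :
    ContDiffOn ℝ ∞ (chr G m j k) U := by
  refine contDiffOn_const.mul (ContDiffOn.sum fun l _ => (contDiffOn_ginv hG hdet m l).mul ?_)
  exact ((contDiffOn_pd hU (hG k l) j).add (contDiffOn_pd hU (hG j l) k)).sub
    (contDiffOn_pd hU (hG j k) l)

theorem sum_mul_ginv (hdet : (G y).det ≠ 0) (k : Fin 4) (X : Fin 4 → ℝ) :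
    ∑ m, G y k m * ∑ l, ginv G y m l * X l = X k := by
  have h : (G y).mulVec ((G y)⁻¹.mulVec X) = X := by
    rw [Matrix.mulVec_mulVec, Matrix.mul_nonsing_inv _ (isUnit_iff_ne_zero.2 hdet),
      Matrix.one_mulVec]
  exact congrFun h k

theorem chr_symm (hsym : ∀ z i j, G z i j = G z j i) (m j k : Fin 4) (y : E4) :
    chr G m j k y = chr G m k j y := by
  have h : (fun z => G z j k) = fun z => G z k j := funext fun z => hsym z j k
  simp only [chr, h]
  congr 1
  exact Finset.sum_congr rfl fun l _ => by ring

theorem sum_mul_chr (hdet : (G y).det ≠ 0) (i j k : Fin 4) :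
    ∑ m, G y k m * chr G m i j y =
      (1 / 2) * (pd i (fun z => G z j k) y + pd j (fun z => G z i k) y
        - pd k (fun z => G z i j) y) := by
  rw [← sum_mul_ginv hdet k fun l => (1 / 2) * (pd i (fun z => G z j l) y
    + pd j (fun z => G z i l) y - pd l (fun z => G z i j) y)]
  refine Finset.sum_congr rfl fun m _ => ?_
  simp only [chr, Finset.mul_sum]
  exact Finset.sum_congr rfl fun l _ => by ring

/-- The Levi-Civita connection is metric. -/
theorem pd_metric (hsym : ∀ z i j, G z i j = G z j i) (hdet : (G y).det ≠ 0) (i j k : Fin 4) :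
    pd i (fun z => G z j k) y =
      ∑ m, (chr G m i j y * G y m k + chr G m i k y * G y m j) := by
  have h1 := sum_mul_chr hdet i j k
  have h2 := sum_mul_chr hdet i k j
  have h : (fun z => G z k j) = fun z => G z j k := funext fun z => hsym z k j
  rw [h] at h2
  have h3 : ∑ m, (chr G m i j y * G y m k + chr G m i k y * G y m j) =
      ∑ m, G y k m * chr G m i j y + ∑ m, G y j m * chr G m i k y := by
    rw [← Finset.sum_add_distrib]
    exact Finset.sum_congr rfl fun m _ => by rw [hsym y m k, hsym y m j]; ring
  rw [h3, h1, h2]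
  ring

theorem riem_antisymm_left (j k l m : Fin 4) : riem G j k l m y = -riem G k j l m y := by
  simp only [riem, riemUp, ← Finset.sum_neg_distrib]
  refine Finset.sum_congr rfl fun p _ => ?_
  rw [← neg_mul]
  congr 1
  rw [neg_add, ← Finset.sum_neg_distrib]
  congr 1
  · ring
  · exact Finset.sum_congr rfl fun _ _ => by ring

/-- The first Bianchi identity. -/
theorem riem_cyclic (hsym : ∀ z i j, G z i j = G z j i) (j k l m : Fin 4) :
    riem G j k l m y + riem G k l j m y + riem G l j k m y = 0 := by
  have hc : ∀ p a b, chr G p a b = chr G p b a := fun p a b => funext (chr_symm hsym p a b)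
  simp only [riem, ← Finset.sum_add_distrib]
  refine Finset.sum_eq_zero fun p _ => ?_
  simp only [riemUp]
  rw [hc p j l, hc p l k, hc p k j]
  have : ∀ q, chr G q j l y = chr G q l j y ∧ chr G q k l y = chr G q l k y ∧
      chr G q j k y = chr G q k j y := fun q => ⟨by rw [hc], by rw [hc], by rw [hc]⟩
  simp only [Fin.sum_univ_four, this]
  ring

theorem riem_antisymm_right (hU : IsOpen U) (hG : ∀ i j, ContDiffOn ℝ ∞ (fun z => G z i j) U)
    (hsym : ∀ z i j, G z i j = G z j i) (hdet : ∀ z ∈ U, (G z).det ≠ 0) (hy : y ∈ U)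
    (j k l m : Fin 4) : riem G j k l m y = -riem G j k m l y := by
  have dG : ∀ a b, DifferentiableAt ℝ (fun z => G z a b) y := fun a b =>
    differentiableAt_of_contDiffOn hU (hG a b) hy
  have dC : ∀ a b c, DifferentiableAt ℝ (chr G a b c) y := fun a b c =>
    differentiableAt_of_contDiffOn hU (contDiffOn_chr hU hG hdet a b c) hy
  have key : ∀ a b : Fin 4, pd a (pd b (fun z => G z l m)) y =
      ∑ p, ((pd a (chr G p b l) y * G y p m + chr G p b l y * pd a (fun z => G z p m) y)
        + (pd a (chr G p b m) y * G y p l + chr G p b m y * pd a (fun z => G z p l) y)) := by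
    intro a b
    rw [pd_congr hU hy (fun z hz => pd_metric hsym (hdet z hz) b l m),
      pd_sum fun p => ((dC _ _ _).fun_mul (dG _ _)).fun_add ((dC _ _ _).fun_mul (dG _ _))]
    refine Finset.sum_congr rfl fun p _ => ?_
    rw [pd_add ((dC _ _ _).fun_mul (dG _ _)) ((dC _ _ _).fun_mul (dG _ _)), pd_mul (dC _ _ _) (dG _ _),
      pd_mul (dC _ _ _) (dG _ _)]
  have h := pd_comm hU (hG l m) hy j k
  rw [key, key] at h
  simp only [pd_metric hsym (hdet y hy)] at h
  simp only [riem, riemUp]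
  simp only [Fin.sum_univ_four, hsym y 1 0, hsym y 2 0, hsym y 3 0, hsym y 2 1, hsym y 3 1,
    hsym y 3 2] at h ⊢
  linear_combination -h

theorem riem_pair_symm (hU : IsOpen U) (hG : ∀ i j, ContDiffOn ℝ ∞ (fun z => G z i j) U)
    (hsym : ∀ z i j, G z i j = G z j i) (hdet : ∀ z ∈ U, (G z).det ≠ 0) (hy : y ∈ U)
    (j k l m : Fin 4) : riem G j k l m y = riem G l m j k y := by
  have A := fun a b c d => riem_antisymm_left (G := G) (y := y) a b c d
  have B := fun a b c d => riem_antisymm_right hU hG hsym hdet hy a b c d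
  have C := fun a b c d => riem_cyclic hsym (y := y) a b c d
  linarith [C j k l m, C k l m j, C l m j k, C m j k l, A j k l m, A k l j m, A l j k m,
    B k l m j, B l m k j, A m k l j, B m k l j, B l m j k, A m j l k, B m j l k, A j l m k,
    B j l m k, B m j k l, B j k m l, A k m j l, B k m j l, B j k l m, B k l j m, B l j k m,
    A l m k j, A j k m l, A l m j k, A k m l j, A k m j l]

/-- The Ricci identity for a covector field with `∇_j w_k = -w_j a_k`. -/
theorem sum_riemUp_mul (hU : IsOpen U) (hG : ∀ i j, ContDiffOn ℝ ∞ (fun z => G z i j) U)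
    (hdet : ∀ z ∈ U, (G z).det ≠ 0) (hsym : ∀ z i j, G z i j = G z j i)
    (hy : y ∈ U) {w a : Fin 4 → E4 → ℝ}
    (hw : ∀ i, ContDiffOn ℝ ∞ (w i) U) (ha : ∀ i, ContDiffOn ℝ ∞ (a i) U)
    (h : ∀ z ∈ U, ∀ j k, nabla G w j k z = -(w j z * a k z)) (j k l : Fin 4) :
    ∑ m, riemUp G j k l m y * w m y =
      w j y * (nabla G a k l y + a k y * a l y) - w k y * (nabla G a j l y + a j y * a l y) := by
  have dw := fun i => differentiableAt_of_contDiffOn hU (hw i) hy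
  have da := fun i => differentiableAt_of_contDiffOn hU (ha i) hy
  have dC : ∀ a b c, DifferentiableAt ℝ (chr G a b c) y := fun a b c =>
    differentiableAt_of_contDiffOn hU (contDiffOn_chr hU hG hdet a b c) hy
  have h1 : ∀ z ∈ U, ∀ i b, pd i (w b) z = ∑ m, chr G m i b z * w m z - w i z * a b z := by
    intro z hz i b
    have := h z hz i b
    rw [nabla] at this
    linarith
  have key : ∀ i b c : Fin 4, pd i (pd b (w c)) y =
      ∑ m, (pd i (chr G m b c) y * w m y + chr G m b c y * pd i (w m) y)
        - (pd i (w b) y * a c y + w b y * pd i (a c) y) := by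
    intro i b c
    rw [pd_congr hU hy (fun z hz => h1 z hz b c),
      pd_sub (DifferentiableAt.fun_sum fun m _ => (dC _ _ _).fun_mul (dw _)) ((dw _).fun_mul (da _)),
      pd_sum fun m => (dC _ _ _).fun_mul (dw _), pd_mul (dw _) (da _)]
    congr 1
    exact Finset.sum_congr rfl fun m _ => pd_mul (dC _ _ _) (dw _) i
  have hs := pd_comm hU (hw l) hy j k
  rw [key, key] at hs
  simp only [h1 y hy] at hs
  have hc : ∀ p, chr G p k j y = chr G p j k y := fun p => chr_symm hsym p k j y
  simp only [riemUp, nabla]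
  simp only [Fin.sum_univ_four, hc] at hs ⊢
  linear_combination -hs

end Coordinates

section Algebra

/-- The action of a matrix on all four indices of a tensor. -/
def transform (A : Matrix (Fin 4) (Fin 4) ℝ) (C : Fin 4 → Fin 4 → Fin 4 → Fin 4 → ℝ)
    (j k l m : Fin 4) : ℝ :=
  ∑ a, ∑ b, ∑ c, ∑ d, A j a * A k b * A l c * A m d * C a b c d

variable {A : Matrix (Fin 4) (Fin 4) ℝ} {C : Fin 4 → Fin 4 → Fin 4 → Fin 4 → ℝ}

theorem sum_comm_pairs (f : Fin 4 → Fin 4 → Fin 4 → Fin 4 → ℝ) :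
    ∑ a, ∑ b, ∑ c, ∑ d, f a b c d = ∑ c, ∑ d, ∑ a, ∑ b, f a b c d := by
  simp only [← Fintype.sum_prod_type']
  exact Fintype.sum_equiv
    { toFun := fun x => (x.2.2.1, x.2.2.2, x.1, x.2.1)
      invFun := fun x => (x.2.2.1, x.2.2.2, x.1, x.2.1)
      left_inv := fun _ => rfl
      right_inv := fun _ => rfl } _ _ fun _ => rfl

theorem transform_antisymm_left (h : ∀ a b c d, C a b c d = -C b a c d) (j k l m : Fin 4) :
    transform A C j k l m = -transform A C k j l m := by
  rw [transform, Finset.sum_comm, transform]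
  simp only [← Finset.sum_neg_distrib]
  refine Finset.sum_congr rfl fun b _ => Finset.sum_congr rfl fun a _ =>
    Finset.sum_congr rfl fun c _ => Finset.sum_congr rfl fun d _ => ?_
  rw [h]
  ring

theorem transform_pair_symm (h : ∀ a b c d, C a b c d = C c d a b) (j k l m : Fin 4) :
    transform A C j k l m = transform A C l m j k := by
  rw [transform, sum_comm_pairs, transform]
  refine Finset.sum_congr rfl fun b _ => Finset.sum_congr rfl fun a _ =>
    Finset.sum_congr rfl fun c _ => Finset.sum_congr rfl fun d _ => ?_
  rw [h]
  ring

theorem transform_eq_nested (j k l m : Fin 4) :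
    transform A C j k l m =
      ∑ a, A j a * ∑ b, A k b * ∑ c, A l c * ∑ d, A m d * C a b c d := by
  simp only [transform, Finset.mul_sum, mul_assoc]

theorem eq_zero_of_transform_eq_zero (hA : A.det ≠ 0)
    (h : ∀ j k l m, transform A C j k l m = 0) (j k l m : Fin 4) : C j k l m = 0 := by
  have key : ∀ X : Fin 4 → ℝ, (∀ i, ∑ a, A i a * X a = 0) → ∀ a, X a = 0 := fun X hX =>
    congrFun (Matrix.eq_zero_of_mulVec_eq_zero hA (funext hX))
  simp only [transform_eq_nested] at h
  exact key _ (fun m => key _ (fun l => key _ (fun k => key _ (fun j => h j k l m) j) k) l) m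

theorem sum_mul_transform (N : Matrix (Fin 4) (Fin 4) ℝ) (k l : Fin 4) :
    ∑ j, ∑ m, N j m * transform A C j k l m =
      ∑ b, ∑ c, A k b * A l c * ∑ a, ∑ d, (∑ j, ∑ m, A j a * N j m * A m d) * C a b c d := by
  simp only [transform, Finset.mul_sum, Finset.sum_mul]
  have e1 : ∀ f : Fin 4 → Fin 4 → Fin 4 → Fin 4 → ℝ,
      ∑ a, ∑ b, ∑ c, ∑ d, f a b c d = ∑ b, ∑ c, ∑ a, ∑ d, f a b c d := fun f => by
    rw [Finset.sum_comm]
    exact Finset.sum_congr rfl fun b _ => Finset.sum_comm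
  refine (Finset.sum_congr rfl fun j _ => Finset.sum_congr rfl fun m _ => e1 _).trans ?_
  rw [sum_comm_pairs]
  refine Finset.sum_congr rfl fun b _ => Finset.sum_congr rfl fun c _ => ?_
  rw [sum_comm_pairs]
  refine Finset.sum_congr rfl fun a _ => Finset.sum_congr rfl fun d _ =>
    Finset.sum_congr rfl fun j _ => Finset.sum_congr rfl fun m _ => ?_
  ring

/-- A non-null vector is the first member of an orthogonal basis. -/
theorem exists_orthogonal_matrix {g : Matrix (Fin 4) (Fin 4) ℝ} (hsym : ∀ i j, g i j = g j i)
    (hdet : g.det ≠ 0) {v : Fin 4 → ℝ} (hv : ∑ i, ∑ j, g i j * v i * v j ≠ 0) :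
    ∃ (P : Matrix (Fin 4) (Fin 4) ℝ) (d : Fin 4 → ℝ), (∀ i, P i 0 = v i) ∧
      P.transpose * g * P = Matrix.diagonal d ∧ P.det ≠ 0 ∧ ∀ i, d i ≠ 0 := by
  set B : LinearMap.BilinForm ℝ (Fin 4 → ℝ) := Matrix.toBilin' g with hB
  have hBapp : ∀ x z, B x z = ∑ i, ∑ j, x i * g i j * z j := fun x z =>
    Matrix.toBilin'_apply g x z
  have hBs : ∀ x z, B x z = B z x := fun x z => by
    rw [hBapp, hBapp, Finset.sum_comm]
    exact Finset.sum_congr rfl fun i _ => Finset.sum_congr rfl fun j _ => by rw [hsym]; ring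
  have hvv : B v v ≠ 0 := by
    rw [hBapp]
    simpa only [mul_comm (v _) (g _ _)] using hv
  set V := LinearMap.ker (B v) with hV
  have hrank : Module.finrank ℝ V = 3 := by
    have h0 : B v ≠ 0 := fun h => hvv (by rw [h]; rfl)
    have := Module.Dual.finrank_ker_add_one_of_ne_zero h0
    rw [Module.finrank_fintype_fun_eq_card, Fintype.card_fin] at this
    exact Nat.succ_injective this
  have hBV : LinearMap.IsSymm (B.restrict V) := ⟨fun x z => hBs x z⟩
  obtain ⟨b', hb'⟩ := LinearMap.BilinForm.exists_orthogonal_basis hBV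
  set b : Module.Basis (Fin 3) ℝ V := b'.reindex (finCongr hrank)
  have hb : ∀ i j, i ≠ j → B (b i) (b j) = 0 := fun i j hij => by
    have : B.restrict V (b' ((finCongr hrank).symm i)) (b' ((finCongr hrank).symm j)) = 0 :=
      hb' (by simpa using hij)
    simpa [b] using this
  set c : Fin 4 → (Fin 4 → ℝ) := Fin.cons v fun i => (b i : Fin 4 → ℝ) with hc
  have hvb : ∀ i, B v (b i) = 0 := fun i => (b i).2
  have horth : ∀ i j, i ≠ j → B (c i) (c j) = 0 := by
    intro i j
    refine Fin.cases ?_ (fun i => ?_) i <;> refine Fin.cases ?_ (fun j => ?_) j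
    · simp
    · intro _; simp [hc, hvb j]
    · intro _; simp [hc, hBs _ v, hvb i]
    · intro hij; simpa [hc] using hb i j (fun h => hij (by rw [h]))
  have hlin : LinearIndependent ℝ c := by
    rw [hc, linearIndependent_finCons]
    refine ⟨b.linearIndependent.map' V.subtype V.ker_subtype, fun hmem => hvv ?_⟩
    have : Submodule.span ℝ (Set.range fun i => (b i : Fin 4 → ℝ)) ≤ V := by
      rw [Submodule.span_le]
      rintro _ ⟨i, rfl⟩
      exact (b i).2
    exact this hmem
  set P : Matrix (Fin 4) (Fin 4) ℝ := (Matrix.of c).transpose with hP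
  have hPdet : P.det ≠ 0 := by
    rw [hP, Matrix.det_transpose, ← isUnit_iff_ne_zero, ← Matrix.isUnit_iff_isUnit_det,
      ← Matrix.linearIndependent_rows_iff_isUnit]
    exact hlin
  have hPP : P.transpose * g * P = Matrix.diagonal fun i => B (c i) (c i) := by
    ext i j
    have : (P.transpose * g * P) i j = B (c i) (c j) := by
      rw [hBapp, Finset.sum_comm]
      simp only [Matrix.mul_apply, Finset.sum_mul, hP, Matrix.transpose_apply, Matrix.of_apply]
    rw [this, Matrix.diagonal_apply]
    split_ifs with h
    · rw [h]
    · exact horth i j h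
  refine ⟨P, _, fun i => rfl, hPP, hPdet, fun i hi => ?_⟩
  have h1 := congrArg Matrix.det hPP
  rw [Matrix.det_mul, Matrix.det_mul, Matrix.det_transpose, Matrix.det_diagonal,
    Finset.prod_eq_zero (Finset.mem_univ i) hi] at h1
  exact mul_ne_zero (mul_ne_zero hPdet hdet) hPdet h1

/-- In an orthogonal frame, a trace-free curvature tensor annihilated by the first frame vector
vanishes, because a three-dimensional curvature tensor is determined by its Ricci tensor. -/
theorem eq_zero_of_trace_eq_zero_of_diagonal {d : Fin 4 → ℝ} (hd : ∀ i, d i ≠ 0)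
    (h12 : ∀ a b c e, C a b c e = -C b a c e) (hp : ∀ a b c e, C a b c e = C c e a b)
    (htr : ∀ b c, ∑ a, d a * C a b c a = 0) (h0 : ∀ a b c, C a b c 0 = 0) (a b c e : Fin 4) :
    C a b c e = 0 := by
  have h34 : ∀ a b c e, C a b c e = -C a b e c := fun a b c e => by rw [hp, h12, hp]
  have hdiag : ∀ a c e, C a a c e = 0 := fun a c e => by linarith [h12 a a c e]
  have hdiag' : ∀ a c e, C c e a a = 0 := fun a c e => by linarith [h34 c e a a]
  have h0' : ∀ a b c, C a b 0 c = 0 := fun a b c => by rw [h34, h0, neg_zero]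
  have h0'' : ∀ a b c, C 0 a b c = 0 := fun a b c => by rw [hp, h0']
  have h0''' : ∀ a b c, C a 0 b c = 0 := fun a b c => by rw [hp, h0]
  simp only [Fin.sum_univ_four] at htr
  have t11 := htr 1 1
  have t22 := htr 2 2
  have t33 := htr 3 3
  have t12 := htr 1 2
  have t13 := htr 1 3
  have t23 := htr 2 3
  simp only [h0'', hdiag, hdiag', mul_zero, add_zero, zero_add] at t11 t22 t33 t12 t13 t23
  have n1 := hd 1
  have n2 := hd 2
  have n3 := hd 3
  have k12 : C 1 2 1 2 = 0 := by
    have : d 1 * d 2 * C 1 2 1 2 = 0 := by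
      have e1 : C 2 1 1 2 = -C 1 2 1 2 := h12 _ _ _ _
      have e2 : C 1 2 2 1 = -C 1 2 1 2 := h34 _ _ _ _
      have e3 : C 1 3 3 1 = C 3 1 1 3 := by rw [h12, h34, neg_neg]
      have e4 : C 2 3 3 2 = C 3 2 2 3 := by rw [h12, h34, neg_neg]
      rw [e1] at t11
      rw [e2] at t22
      rw [e3, e4] at t33
      linear_combination -(1 / 2) * (d 1 * t11 + d 2 * t22 - d 3 * t33)
    simpa [n1, n2] using this
  have k13 : C 1 3 1 3 = 0 := by
    have e1 : C 2 1 1 2 = 0 := by rw [h12, k12, neg_zero]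
    rw [e1, mul_zero, zero_add] at t11
    have : C 3 1 1 3 = 0 := by simpa [n3] using t11
    rw [h12, this, neg_zero]
  have k23 : C 2 3 2 3 = 0 := by
    have e1 : C 1 2 2 1 = 0 := by rw [h34, k12, neg_zero]
    rw [e1, mul_zero, zero_add] at t22
    have : C 3 2 2 3 = 0 := by simpa [n3] using t22
    rw [h12, this, neg_zero]
  have k1323 : C 1 3 2 3 = 0 := by
    have : C 3 1 2 3 = 0 := by simpa [n3] using t12
    rw [h12, this, neg_zero]
  have k1223 : C 1 2 2 3 = 0 := by
    have : C 2 1 3 2 = 0 := by simpa [n2] using t13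
    rw [h12, h34, this, neg_zero, neg_zero]
  have k1213 : C 1 2 1 3 = 0 := by
    have : C 1 2 3 1 = 0 := by simpa [n1] using t23
    rw [h34, this, neg_zero]
  have r12 : ∀ c e, C 1 2 c e = 0 := by
    intro c e
    fin_cases c <;> fin_cases e <;>
      simp [h0, h0', hdiag', k12, k1213, k1223, h34 1 2 2 1, h34 1 2 3 1, h34 1 2 3 2]
  have r13 : ∀ c e, C 1 3 c e = 0 := by
    intro c e
    fin_cases c <;> fin_cases e <;>
      simp [h0, h0', hdiag', k13, k1323, hp 1 3 1 2, hp 1 3 2 1, r12, h12 2 1 1 3,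
        h34 1 3 3 1, h34 1 3 3 2]
  have r23 : ∀ c e, C 2 3 c e = 0 := by
    intro c e
    fin_cases c <;> fin_cases e <;>
      simp [h0, h0', hdiag', k23, hp 2 3 1 2, hp 2 3 2 1, hp 2 3 1 3, hp 2 3 3 1, r12, r13,
        h12 2 1 2 3, h12 3 1 2 3, h34 2 3 3 2]
  fin_cases a <;> fin_cases b <;>
    simp [h0'', h0''', hdiag, r12, r13, r23, h12 2 1 c e, h12 3 1 c e, h12 3 2 c e]

theorem eq_zero_of_trace_eq_zero {g : Matrix (Fin 4) (Fin 4) ℝ} (hsym : ∀ i j, g i j = g j i)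
    (hdet : g.det ≠ 0) {v : Fin 4 → ℝ} (hv : ∑ i, ∑ j, g i j * v i * v j ≠ 0)
    (h12 : ∀ a b c e, C a b c e = -C b a c e) (hp : ∀ a b c e, C a b c e = C c e a b)
    (htr : ∀ b c, ∑ a, ∑ e, g⁻¹ a e * C a b c e = 0) (h0 : ∀ a b c, ∑ e, C a b c e * v e = 0)
    (a b c e : Fin 4) : C a b c e = 0 := by
  obtain ⟨P, d, hP0, hPP, hPdet, hd⟩ := exists_orthogonal_matrix hsym hdet hv
  have hinv : g⁻¹ = P * Matrix.diagonal (fun i => (d i)⁻¹) * P.transpose := by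
    apply Matrix.inv_eq_right_inv
    have hu : IsUnit P.transpose.det := by
      rw [Matrix.det_transpose]; exact isUnit_iff_ne_zero.2 hPdet
    have h1 : P.transpose * (g * (P * Matrix.diagonal (fun i => (d i)⁻¹) * P.transpose)) =
        P.transpose * 1 := by
      calc _ = (P.transpose * g * P) * Matrix.diagonal (fun i => (d i)⁻¹) * P.transpose := by
            simp only [Matrix.mul_assoc]
        _ = P.transpose * 1 := by
            rw [hPP, Matrix.diagonal_mul_diagonal]
            simp [hd]
    have := congrArg (fun X => (P.transpose)⁻¹ * X) h1
    simpa only [Matrix.nonsing_inv_mul_cancel_left _ _ hu] using this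
  refine eq_zero_of_transform_eq_zero (A := P.transpose) (by rwa [Matrix.det_transpose])
    (eq_zero_of_trace_eq_zero_of_diagonal (d := fun i => (d i)⁻¹)
      (fun i => inv_ne_zero (hd i)) (transform_antisymm_left h12) (transform_pair_symm hp) ?_ ?_)
    a b c e
  · intro b c
    have h1 := sum_mul_transform (A := P.transpose) (C := C) (Matrix.diagonal fun i => (d i)⁻¹) b c
    have h2 : ∀ a e, ∑ j, ∑ m, P.transpose j a * (Matrix.diagonal (fun i => (d i)⁻¹)) j m *
        P.transpose m e = g⁻¹ a e := by
      intro a e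
      rw [hinv, Finset.sum_comm]
      simp only [Matrix.mul_apply, Finset.sum_mul, Matrix.transpose_apply]
    simp only [h2, htr, mul_zero, Finset.sum_const_zero] at h1
    rw [← h1]
    refine Finset.sum_congr rfl fun j _ => ?_
    simp [Matrix.diagonal_apply]
  · intro a b c
    rw [transform_eq_nested]
    have : ∀ a b c, ∑ e, P.transpose 0 e * C a b c e = 0 := fun a b c => by
      rw [← h0 a b c]
      exact Finset.sum_congr rfl fun e _ => by rw [Matrix.transpose_apply, hP0, mul_comm]
    simp only [this, mul_zero, Finset.sum_const_zero]

end Algebra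

section Contractions

variable {g : Matrix (Fin 4) (Fin 4) ℝ}

theorem sum_inv_mul_right (hdet : g.det ≠ 0) (X : Fin 4 → ℝ)
    (k : Fin 4) : ∑ j, ∑ l, g⁻¹ j l * (X j * g l k) = X k := by
  have h : Matrix.vecMul X (g⁻¹ * g) = X := by
    rw [Matrix.nonsing_inv_mul _ (isUnit_iff_ne_zero.2 hdet), Matrix.vecMul_one]
  rw [← congrFun h k]
  simp only [Matrix.vecMul, dotProduct, Matrix.mul_apply, Finset.mul_sum]
  exact Finset.sum_congr rfl fun j _ => Finset.sum_congr rfl fun l _ => by ring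

theorem inv_symm (hsym : ∀ i j, g i j = g j i) (i j : Fin 4) : g⁻¹ i j = g⁻¹ j i := by
  have h : g.transpose = g := Matrix.ext fun i j => hsym j i
  have h2 := Matrix.transpose_nonsing_inv g
  rw [h] at h2
  exact congrFun (congrFun h2 j) i

theorem sum_inv_mul_left (hdet : g.det ≠ 0) (hsym : ∀ i j, g i j = g j i) (X : Fin 4 → ℝ)
    (k : Fin 4) : ∑ j, ∑ l, g⁻¹ j l * (g j k * X l) = X k := by
  rw [← sum_inv_mul_right hdet X k, Finset.sum_comm]
  refine Finset.sum_congr rfl fun j _ => Finset.sum_congr rfl fun l _ => ?_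
  rw [inv_symm hsym]
  ring

theorem sum_inv_mul_self (hdet : g.det ≠ 0) (hsym : ∀ i j, g i j = g j i) :
    ∑ j, ∑ l, g⁻¹ j l * g j l = 4 := by
  have h : (g⁻¹ * g).trace = 4 := by
    rw [Matrix.nonsing_inv_mul _ (isUnit_iff_ne_zero.2 hdet)]
    simp
  rw [← h]
  simp only [Matrix.trace, Matrix.diag, Matrix.mul_apply]
  exact Finset.sum_congr rfl fun j _ => Finset.sum_congr rfl fun l _ => by rw [hsym j l]

theorem sum_inv_mul_lower (hdet : g.det ≠ 0) (v : Fin 4 → ℝ) (j : Fin 4) :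
    ∑ l, g⁻¹ j l * ∑ i, g l i * v i = v j := by
  have h : g⁻¹.mulVec (g.mulVec v) = v := by
    rw [Matrix.mulVec_mulVec, Matrix.nonsing_inv_mul _ (isUnit_iff_ne_zero.2 hdet),
      Matrix.one_mulVec]
  exact congrFun h j

end Contractions

section Electric

variable {g : Matrix (Fin 4) (Fin 4) ℝ} {v w : Fin 4 → ℝ}
  {C : Fin 4 → Fin 4 → Fin 4 → Fin 4 → ℝ} {E : Fin 4 → Fin 4 → ℝ}

/-- A trace-free curvature tensor whose contraction with a unit timelike vector is purely
electric is determined by its electric part. -/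
theorem eq_of_purely_electric (hsym : ∀ i j, g i j = g j i) (hdet : g.det ≠ 0)
    (hw : ∀ k, w k = ∑ l, g k l * v l) (hwv : ∑ k, w k * v k = -1)
    (h12 : ∀ a b c e, C a b c e = -C b a c e) (hp : ∀ a b c e, C a b c e = C c e a b)
    (htr : ∀ b c, ∑ a, ∑ e, g⁻¹ a e * C a b c e = 0)
    (hE : ∀ k l, E k l = ∑ j, ∑ m, v j * C j k l m * v m)
    {Q : Fin 4 → Fin 4 → ℝ}
    (hQ : ∀ j k l, ∑ m, C j k l m * v m = w j * Q k l - w k * Q j l) (j k l m : Fin 4) :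
    C j k l m = (g k l + 2 * w k * w l) * E j m - (g j l + 2 * w j * w l) * E k m
      + (g j m + 2 * w j * w m) * E k l - (g k m + 2 * w k * w m) * E j l := by
  have h34 : ∀ a b c e, C a b c e = -C a b e c := fun a b c e => by rw [hp, h12, hp]
  have hEsym : ∀ k l, E k l = E l k := by
    intro k l
    rw [hE, hE, Finset.sum_comm]
    refine Finset.sum_congr rfl fun j _ => Finset.sum_congr rfl fun m _ => ?_
    rw [hp m k l j, h12 l j m k, h34 j l m k]
    ring
  have hEQ : ∀ k l, E k l = -Q k l - w k * ∑ j, v j * Q j l := by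
    intro k l
    have h1 : E k l = ∑ j, v j * ∑ m, C j k l m * v m := by
      rw [hE]
      simp only [Finset.mul_sum, mul_assoc]
    rw [h1]
    simp only [hQ]
    simp only [Fin.sum_univ_four] at hwv ⊢
    linear_combination (Q k l) * hwv
  have hCv : ∀ j k l, ∑ m, C j k l m * v m = -(w j * E k l) + w k * E j l := by
    intro j k l
    rw [hQ, hEQ, hEQ]
    ring
  have hvE : ∀ l, ∑ k, v k * E k l = 0 := by
    intro l
    simp only [hEQ]
    simp only [Fin.sum_univ_four] at hwv ⊢
    linear_combination -(v 0 * Q 0 l + v 1 * Q 1 l + v 2 * Q 2 l + v 3 * Q 3 l) * hwv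
  have hEv : ∀ k, ∑ l, E k l * v l = 0 := by
    intro k
    rw [← hvE k]
    exact Finset.sum_congr rfl fun l _ => by rw [hEsym, mul_comm]
  have htrE : ∑ k, ∑ l, g⁻¹ k l * E k l = 0 := by
    simp only [hE, Finset.mul_sum]
    rw [sum_comm_pairs]
    refine Finset.sum_eq_zero fun j _ => Finset.sum_eq_zero fun m _ => ?_
    have : v j * v m * ∑ k, ∑ l, g⁻¹ k l * C k j m l = 0 := by rw [htr, mul_zero]
    rw [← this]
    simp only [Finset.mul_sum]
    refine Finset.sum_congr rfl fun k _ => Finset.sum_congr rfl fun l _ => ?_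
    rw [h12 j, h34 k]
    ring
  have hgw : ∀ j, ∑ l, g⁻¹ j l * w l = v j := fun j => by
    simp only [hw]
    exact sum_inv_mul_lower hdet v j
  have hgwr : ∀ X : Fin 4 → ℝ, ∑ j, ∑ l, g⁻¹ j l * (X j * w l) = ∑ j, X j * v j := fun X => by
    refine Finset.sum_congr rfl fun j _ => ?_
    rw [← hgw j, Finset.mul_sum]
    exact Finset.sum_congr rfl fun l _ => by ring
  have hgwl : ∀ X : Fin 4 → ℝ, ∑ j, ∑ l, g⁻¹ j l * (w j * X l) = ∑ j, X j * v j := fun X => by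
    rw [← hgwr X, Finset.sum_comm]
    refine Finset.sum_congr rfl fun j _ => Finset.sum_congr rfl fun l _ => ?_
    rw [inv_symm hsym]
    ring
  rw [← sub_eq_zero]
  refine eq_zero_of_trace_eq_zero (C := fun j k l m => C j k l m -
    ((g k l + 2 * w k * w l) * E j m - (g j l + 2 * w j * w l) * E k m
      + (g j m + 2 * w j * w m) * E k l - (g k m + 2 * w k * w m) * E j l))
    hsym hdet (v := v) ?_ ?_ ?_ ?_ ?_ j k l m
  · have : ∑ i, ∑ j, g i j * v i * v j = -1 := by
      rw [← hwv]
      refine Finset.sum_congr rfl fun i _ => ?_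
      rw [hw, Finset.sum_mul]
      exact Finset.sum_congr rfl fun j _ => by ring
    rw [this]
    norm_num
  · intro j k l m
    rw [h12]
    ring
  · intro j k l m
    rw [hp, hsym m j, hsym l j, hsym l k, hsym m k, hEsym l k, hEsym m k, hEsym m j, hEsym l j]
    ring
  · intro k l
    have t1 := htr k l
    have t2 := sum_inv_mul_left hdet hsym (E k) l
    have t3 := sum_inv_mul_right hdet (fun j => E j l) k
    have t4 := sum_inv_mul_self hdet hsym
    have t5 := hgwl (E k)
    have t6 := hgwr fun j => E j l
    have t7 := hgwr w
    have t8 := hEv k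
    have t9 := hvE l
    simp only [Fin.sum_univ_four, hsym k] at hwv t1 t2 t3 t4 t5 t6 t7 t8 t9 htrE ⊢
    linear_combination t1 - (g l k + 2 * w k * w l) * htrE + t2 + 2 * w l * (t5 + t8)
      - E k l * (t4 + 2 * (t7 + hwv)) + t3 + 2 * w k * (t6 + t9)
  · intro j k l
    have t1 := hCv j k l
    have t2 := hEv j
    have t3 := hEv k
    have t4 := hw j
    have t5 := hw k
    simp only [Fin.sum_univ_four] at hwv t1 t2 t3 t4 t5 ⊢
    linear_combination t1 - (g k l + 2 * w k * w l) * t2 + (g j l + 2 * w j * w l) * t3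
      + E k l * t4 - E j l * t5 - 2 * w j * E k l * hwv + 2 * w k * E j l * hwv

/-- The square of a purely electric Weyl-type tensor. -/
theorem sum_mul_transform_inv (hsym : ∀ i j, g i j = g j i) (hdet : g.det ≠ 0)
    (hw : ∀ k, w k = ∑ l, g k l * v l)
    (h12 : ∀ a b c e, C a b c e = -C b a c e) (hp : ∀ a b c e, C a b c e = C c e a b)
    (htr : ∀ b c, ∑ a, ∑ e, g⁻¹ a e * C a b c e = 0)
    (hE : ∀ k l, E k l = ∑ j, ∑ m, v j * C j k l m * v m)
    (hC : ∀ j k l m, C j k l m = (g k l + 2 * w k * w l) * E j m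
      - (g j l + 2 * w j * w l) * E k m
      + (g j m + 2 * w j * w m) * E k l - (g k m + 2 * w k * w m) * E j l) :
    ∑ j, ∑ k, ∑ l, ∑ m, C j k l m * transform g⁻¹ C j k l m =
      8 * ∑ k, ∑ l, (∑ a, ∑ b, g⁻¹ k a * g⁻¹ l b * E a b) * E k l := by
  set T := transform g⁻¹ C with hT
  have T12 : ∀ a b c e, T a b c e = -T b a c e := transform_antisymm_left h12
  have Tp : ∀ a b c e, T a b c e = T c e a b := transform_pair_symm hp
  have T34 : ∀ a b c e, T a b c e = -T a b e c := fun a b c e => by rw [Tp, T12, Tp]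
  have hgw : ∀ j, ∑ l, g⁻¹ j l * w l = v j := fun j => by
    simp only [hw]
    exact sum_inv_mul_lower hdet v j
  have hg : ∀ k l, ∑ j, ∑ m, g j m * T j k l m = 0 := by
    intro k l
    rw [hT, sum_mul_transform]
    have h1 : ∀ a d, ∑ j, ∑ m, g⁻¹ j a * g j m * g⁻¹ m d = g⁻¹ a d := by
      intro a d
      have : (g⁻¹ * g * g⁻¹) a d = g⁻¹ a d := by
        rw [Matrix.nonsing_inv_mul _ (isUnit_iff_ne_zero.2 hdet), Matrix.one_mul]
      rw [← this, Finset.sum_comm]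
      simp only [Matrix.mul_apply, Finset.sum_mul]
      refine Finset.sum_congr rfl fun j _ => Finset.sum_congr rfl fun m _ => ?_
      rw [inv_symm hsym m a]
    simp only [h1, htr, mul_zero, Finset.sum_const_zero]
  have hww : ∀ k l, ∑ j, ∑ m, w j * w m * T j k l m = ∑ a, ∑ b, g⁻¹ k a * g⁻¹ l b * E a b := by
    intro k l
    have := sum_mul_transform (A := g⁻¹) (C := C) (Matrix.of fun j m => w j * w m) k l
    simp only [Matrix.of_apply] at this
    rw [this]
    have h1 : ∀ a d, ∑ j, ∑ m, g⁻¹ j a * (w j * w m) * g⁻¹ m d = v a * v d := by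
      intro a d
      rw [← hgw a, ← hgw d, Finset.sum_mul_sum]
      refine Finset.sum_congr rfl fun j _ => Finset.sum_congr rfl fun m _ => ?_
      rw [inv_symm hsym a j, inv_symm hsym d m]
      ring
    refine Finset.sum_congr rfl fun b _ => Finset.sum_congr rfl fun c _ => ?_
    rw [hE]
    congr 1
    refine Finset.sum_congr rfl fun a _ => Finset.sum_congr rfl fun d _ => ?_
    rw [h1]
    ring
  have key : ∑ j, ∑ k, ∑ l, ∑ m, (g j m + 2 * w j * w m) * E k l * T j k l m =
      2 * ∑ k, ∑ l, (∑ a, ∑ b, g⁻¹ k a * g⁻¹ l b * E a b) * E k l := by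
    have e1 : ∀ f : Fin 4 → Fin 4 → Fin 4 → Fin 4 → ℝ,
        ∑ j, ∑ k, ∑ l, ∑ m, f j k l m = ∑ k, ∑ l, ∑ j, ∑ m, f j k l m := fun f => by
      rw [Finset.sum_comm]
      exact Finset.sum_congr rfl fun b _ => Finset.sum_comm
    rw [e1, Finset.mul_sum]
    refine Finset.sum_congr rfl fun k _ => ?_
    rw [Finset.mul_sum]
    refine Finset.sum_congr rfl fun l _ => ?_
    rw [← hww]
    have h2 : ∑ j, ∑ m, (g j m + 2 * w j * w m) * E k l * T j k l m =
        E k l * ∑ j, ∑ m, g j m * T j k l m + 2 * E k l * ∑ j, ∑ m, w j * w m * T j k l m := by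
      simp only [Finset.mul_sum, ← Finset.sum_add_distrib]
      exact Finset.sum_congr rfl fun j _ => Finset.sum_congr rfl fun m _ => by ring
    rw [h2, hg]
    ring
  have s1 : ∑ j, ∑ k, ∑ l, ∑ m, (g k l + 2 * w k * w l) * E j m * T j k l m =
      ∑ j, ∑ k, ∑ l, ∑ m, (g j m + 2 * w j * w m) * E k l * T j k l m := by
    rw [Finset.sum_comm]
    refine Finset.sum_congr rfl fun k _ => Finset.sum_congr rfl fun j _ => ?_
    rw [Finset.sum_comm]
    refine Finset.sum_congr rfl fun m _ => Finset.sum_congr rfl fun l _ => ?_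
    rw [T12, T34, neg_neg]
  have s2 : ∑ j, ∑ k, ∑ l, ∑ m, (g j l + 2 * w j * w l) * E k m * T j k l m =
      -∑ j, ∑ k, ∑ l, ∑ m, (g j m + 2 * w j * w m) * E k l * T j k l m := by
    simp only [← Finset.sum_neg_distrib]
    refine Finset.sum_congr rfl fun j _ => Finset.sum_congr rfl fun k _ => ?_
    rw [Finset.sum_comm]
    refine Finset.sum_congr rfl fun m _ => Finset.sum_congr rfl fun l _ => ?_
    rw [T34]
    ring
  have s3 : ∑ j, ∑ k, ∑ l, ∑ m, (g k m + 2 * w k * w m) * E j l * T j k l m =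
      -∑ j, ∑ k, ∑ l, ∑ m, (g j m + 2 * w j * w m) * E k l * T j k l m := by
    rw [Finset.sum_comm]
    simp only [← Finset.sum_neg_distrib]
    refine Finset.sum_congr rfl fun j _ => Finset.sum_congr rfl fun k _ =>
      Finset.sum_congr rfl fun m _ => Finset.sum_congr rfl fun l _ => ?_
    rw [T12]
    ring
  have hsplit : ∑ j, ∑ k, ∑ l, ∑ m, C j k l m * T j k l m =
      ∑ j, ∑ k, ∑ l, ∑ m, (g k l + 2 * w k * w l) * E j m * T j k l m
      - ∑ j, ∑ k, ∑ l, ∑ m, (g j l + 2 * w j * w l) * E k m * T j k l m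
      + ∑ j, ∑ k, ∑ l, ∑ m, (g j m + 2 * w j * w m) * E k l * T j k l m
      - ∑ j, ∑ k, ∑ l, ∑ m, (g k m + 2 * w k * w m) * E j l * T j k l m := by
    simp only [← Finset.sum_sub_distrib, ← Finset.sum_add_distrib]
    refine Finset.sum_congr rfl fun j _ => Finset.sum_congr rfl fun k _ =>
      Finset.sum_congr rfl fun l _ => Finset.sum_congr rfl fun m _ => ?_
    rw [hC j k l m]
    ring
  rw [hsplit, s1, s2, s3, key]
  ring

end Electric

section Weyl

variable {U : Set E4} {y : E4} {G : E4 → Matrix (Fin 4) (Fin 4) ℝ} {v : Fin 4 → E4 → ℝ}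

theorem contDiffOn_lower (hG : ∀ i j, ContDiffOn ℝ ∞ (fun z => G z i j) U)
    (hv : ∀ i, ContDiffOn ℝ ∞ (v i) U) (k : Fin 4) : ContDiffOn ℝ ∞ (lower G v k) U :=
  ContDiffOn.sum fun l _ => (hG k l).mul (hv l)

theorem contDiffOn_acc (hU : IsOpen U) (hG : ∀ i j, ContDiffOn ℝ ∞ (fun z => G z i j) U)
    (hdet : ∀ z ∈ U, (G z).det ≠ 0) (hv : ∀ i, ContDiffOn ℝ ∞ (v i) U) (k : Fin 4) :
    ContDiffOn ℝ ∞ (acc G v k) U :=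
  ContDiffOn.sum fun j _ => (hv j).mul <|
    (contDiffOn_pd hU (contDiffOn_lower hG hv k) j).sub <|
      ContDiffOn.sum fun m _ => (contDiffOn_chr hU hG hdet m j k).mul (contDiffOn_lower hG hv m)

theorem ricci_symm (hU : IsOpen U) (hG : ∀ i j, ContDiffOn ℝ ∞ (fun z => G z i j) U)
    (hsym : ∀ z i j, G z i j = G z j i) (hdet : ∀ z ∈ U, (G z).det ≠ 0) (hy : y ∈ U)
    (k m : Fin 4) : ricci G k m y = ricci G m k y := by
  rw [ricci, ricci, Finset.sum_comm]
  refine Finset.sum_congr rfl fun l _ => Finset.sum_congr rfl fun j _ => ?_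
  rw [riem_pair_symm hU hG hsym hdet hy j k l m, ginv, ginv, inv_symm (hsym y)]

theorem weyl_antisymm_left (j k l m : Fin 4) : weyl G j k l m y = -weyl G k j l m y := by
  rw [weyl, weyl, riem_antisymm_left]
  ring

theorem weyl_pair_symm (hU : IsOpen U) (hG : ∀ i j, ContDiffOn ℝ ∞ (fun z => G z i j) U)
    (hsym : ∀ z i j, G z i j = G z j i) (hdet : ∀ z ∈ U, (G z).det ≠ 0) (hy : y ∈ U)
    (j k l m : Fin 4) : weyl G j k l m y = weyl G l m j k y := by
  have hR := ricci_symm hU hG hsym hdet hy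
  rw [weyl, weyl, riem_pair_symm hU hG hsym hdet hy j k l m, hsym y m j, hsym y l j,
    hsym y l k, hsym y m k, hR l k, hR m k, hR m j, hR l j]
  ring

theorem weyl_trace (hU : IsOpen U) (hG : ∀ i j, ContDiffOn ℝ ∞ (fun z => G z i j) U)
    (hsym : ∀ z i j, G z i j = G z j i) (hdet : ∀ z ∈ U, (G z).det ≠ 0) (hy : y ∈ U)
    (k l : Fin 4) : ∑ j, ∑ m, (G y)⁻¹ j m * weyl G j k l m y = 0 := by
  have t1 : ∑ j, ∑ m, (G y)⁻¹ j m * riem G j k l m y = -ricci G k l y := by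
    simp only [ricci, ← Finset.sum_neg_distrib]
    refine Finset.sum_congr rfl fun j _ => Finset.sum_congr rfl fun m _ => ?_
    rw [riem_antisymm_right hU hG hsym hdet hy j k l m, mul_neg, ginv]
  have t2 := sum_inv_mul_self (hdet y hy) (hsym y)
  have t3 := sum_inv_mul_right (hdet y hy) (fun j => ricci G j l y) k
  have t4 : ∑ j, ∑ m, (G y)⁻¹ j m * ricci G j m y = scal G y := rfl
  have t5 := sum_inv_mul_left (hdet y hy) (hsym y) (fun m => ricci G k m y) l
  have t6 := sum_inv_mul_left (hdet y hy) (hsym y) (G y k) l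
  simp only [weyl]
  simp only [Fin.sum_univ_four, hsym y k] at t1 t2 t3 t4 t5 t6 ⊢
  linear_combination t1 + (1 / 2) * (ricci G k l y * t2 - t3 + G y l k * t4 - t5)
    - (scal G y / 6) * (G y l k * t2 - t6)

/-- In a static spacetime the Weyl tensor is purely electric with respect to the velocity. -/
theorem exists_weyl_mul_velocity (hU : IsOpen U)
    (hG : ∀ i j, ContDiffOn ℝ ∞ (fun z => G z i j) U)
    (hsym : ∀ z i j, G z i j = G z j i) (hdet : ∀ z ∈ U, (G z).det ≠ 0) (hy : y ∈ U)
    (hv : ∀ i, ContDiffOn ℝ ∞ (v i) U)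
    (hnorm : ∑ k, lower G v k y * v k y = -1)
    (hnabla : ∀ z ∈ U, ∀ j k, nabla G (lower G v) j k z = -(lower G v j z * acc G v k z)) :
    ∃ Q : Fin 4 → Fin 4 → ℝ, ∀ j k l,
      ∑ m, weyl G j k l m y * v m y = lower G v j y * Q k l - lower G v k y * Q j l := by
  set w := fun k => lower G v k y with hw
  set S : Fin 4 → Fin 4 → ℝ := fun k l => nabla G (acc G v) k l y + acc G v k y * acc G v l y
    with hS
  have hwd : ∀ k, w k = ∑ l, G y k l * v l y := fun k => rfl
  have hR : ∀ j k l, ∑ m, riem G j k l m y * v m y = w j * S k l - w k * S j l := by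
    intro j k l
    rw [← sum_riemUp_mul hU hG hdet hsym hy (contDiffOn_lower hG hv)
      (contDiffOn_acc hU hG hdet hv) hnabla j k l]
    simp only [riem, Finset.sum_mul]
    rw [Finset.sum_comm]
    refine Finset.sum_congr rfl fun p _ => ?_
    rw [lower, Finset.mul_sum]
    exact Finset.sum_congr rfl fun m _ => mul_assoc _ _ _
  set s : Fin 4 → ℝ := fun k => ∑ l, S k l * v l y with hs
  set σ : ℝ := ∑ j, v j y * s j with hσ
  have hws : ∀ j k, w j * s k - w k * s j = 0 := by
    intro j k
    have h1 : w j * s k - w k * s j = ∑ l, ∑ m, riem G j k l m y * v m y * v l y := by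
      simp only [hs, Finset.mul_sum, ← Finset.sum_sub_distrib, ← Finset.sum_mul, hR]
      exact Finset.sum_congr rfl fun l _ => by ring
    have h2 : ∑ l, ∑ m, riem G j k l m y * v m y * v l y =
        -∑ l, ∑ m, riem G j k l m y * v m y * v l y := by
      conv_lhs => rw [Finset.sum_comm]
      simp only [← Finset.sum_neg_distrib]
      refine Finset.sum_congr rfl fun l _ => Finset.sum_congr rfl fun m _ => ?_
      rw [riem_antisymm_right hU hG hsym hdet hy]
      ring
    linarith
  have hsσ : ∀ k, s k = -(w k * σ) := by
    intro k
    have a0 := hws 0 k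
    have a1 := hws 1 k
    have a2 := hws 2 k
    have a3 := hws 3 k
    simp only [Fin.sum_univ_four] at hnorm hσ
    rw [hσ]
    linear_combination -(v 0 y * a0 + v 1 y * a1 + v 2 y * a2 + v 3 y * a3) + s k * hnorm
  have hgw : ∀ j, ∑ l, (G y)⁻¹ j l * w l = v j y := sum_inv_mul_lower (hdet y hy) fun l => v l y
  have hRic : ∀ k, ∑ m, ricci G k m y * v m y =
      -(σ + ∑ j, ∑ l, (G y)⁻¹ j l * S j l) * w k := by
    intro k
    have h1 : ∑ m, ricci G k m y * v m y =
        ∑ j, ∑ l, (G y)⁻¹ j l * ∑ m, riem G j k l m y * v m y := by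
      simp only [ricci, Finset.sum_mul, Finset.mul_sum]
      rw [Finset.sum_comm]
      refine Finset.sum_congr rfl fun j _ => ?_
      rw [Finset.sum_comm]
      exact Finset.sum_congr rfl fun l _ => Finset.sum_congr rfl fun m _ => mul_assoc _ _ _
    have h2 : ∑ j, ∑ l, (G y)⁻¹ j l * (w j * S k l) = s k := by
      rw [Finset.sum_comm]
      refine Finset.sum_congr rfl fun l _ => ?_
      rw [← hgw l, Finset.mul_sum]
      refine Finset.sum_congr rfl fun j _ => ?_
      rw [inv_symm (hsym y)]
      ring
    have h3 : ∑ j, ∑ l, (G y)⁻¹ j l * (w j * S k l - w k * S j l) =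
        ∑ j, ∑ l, (G y)⁻¹ j l * (w j * S k l) - w k * ∑ j, ∑ l, (G y)⁻¹ j l * S j l := by
      simp only [Finset.mul_sum, ← Finset.sum_sub_distrib]
      exact Finset.sum_congr rfl fun j _ => Finset.sum_congr rfl fun l _ => by ring
    rw [h1]
    simp only [hR]
    rw [h3, h2, hsσ]
    ring
  set ρ : ℝ := -(σ + ∑ j, ∑ l, (G y)⁻¹ j l * S j l) with hρ
  refine ⟨fun k l => S k l + (1 / 2) * (ricci G k l y + ρ * G y k l)
    - scal G y / 6 * G y k l, fun j k l => ?_⟩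
  have t1 := hR j k l
  have t2 := hwd j
  have t3 := hwd k
  have t4 := hRic j
  have t5 := hRic k
  change _ = w j * _ - w k * _
  simp only [weyl]
  simp only [Fin.sum_univ_four] at t1 t2 t3 t4 t5 ⊢
  linear_combination t1 - (1 / 2) * (ricci G k l y * t2 - ricci G j l y * t3
    - G y k l * t4 + G y j l * t5) + scal G y / 6 * (G y k l * t2 - G y j l * t3)

end Weyl

end StaticSpacetime

theorem mainTheorem2 {M : Type*} [TopologicalSpace M] [ChartedSpace StaticSpacetime.E4 M]
    [IsManifold (𝓡 4) ∞ M] (g : StaticSpacetime.LorentzianMetric M)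
    (u : ∀ p : M, TangentSpace (𝓡 4) p) (hu : StaticSpacetime.IsStaticVelocity g u)
    (e : OpenPartialHomeomorph M StaticSpacetime.E4)
    (he : e ∈ IsManifold.maximalAtlas (𝓡 4) ∞ M)
    (y : StaticSpacetime.E4) (hy : y ∈ e.target) :
    let G : StaticSpacetime.E4 → Matrix (Fin 4) (Fin 4) ℝ := g.comp e
    let v : Fin 4 → StaticSpacetime.E4 → ℝ := StaticSpacetime.vecComp u e
    let ul : Fin 4 → ℝ := fun k => StaticSpacetime.lower G v k y
    let E : Fin 4 → Fin 4 → ℝ := fun k l => StaticSpacetime.elec G v k l y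
    (∀ j k l m : Fin 4,
      StaticSpacetime.weyl G j k l m y =
        (G y k l + 2 * ul k * ul l) * E j m - (G y j l + 2 * ul j * ul l) * E k m
          + (G y j m + 2 * ul j * ul m) * E k l - (G y k m + 2 * ul k * ul m) * E j l) ∧
    (∑ j, ∑ k, ∑ l, ∑ m,
        StaticSpacetime.weyl G j k l m y * StaticSpacetime.weylRaised G j k l m y) =
      8 * ∑ k, ∑ l, StaticSpacetime.elecRaised G v k l y * E k l := by
  open StaticSpacetime in
  intro G v ul E
  have hU := e.open_target
  have hG := g.contDiffOn_comp he
  have hsym := g.comp_symm e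
  have hdet : ∀ z ∈ e.target, (G z).det ≠ 0 := fun z hz => g.det_comp_ne_zero he hz
  have hv := contDiffOn_vecComp hu.contMDiff he
  have hnorm : ∑ k, ul k * v k y = -1 := by
    rw [← hu.normalized (e.symm y), ← g.sum_comp_vecComp he u hy]
    refine Finset.sum_congr rfl fun i _ => ?_
    simp only [ul, lower, Finset.sum_mul]
    exact Finset.sum_congr rfl fun j _ => mul_right_comm _ _ _
  obtain ⟨Q, hQ⟩ := exists_weyl_mul_velocity hU hG hsym hdet hy hv hnorm
    (hu.nabla_velocity e he)
  have hp := weyl_pair_symm hU hG hsym hdet hy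
  have htr := weyl_trace hU hG hsym hdet hy
  have h12 : ∀ a b c d, weyl G a b c d y = -weyl G b a c d y := weyl_antisymm_left
  have hC := eq_of_purely_electric (g := G y) (v := fun k => v k y) (w := ul) (E := E)
    (C := fun a b c d => weyl G a b c d y) (hsym y) (hdet y hy) (fun _ => rfl) hnorm h12 hp htr
    (fun _ _ => rfl) hQ
  exact ⟨hC, sum_mul_transform_inv (g := G y) (v := fun k => v k y) (w := ul) (E := E)
    (C := fun a b c d => weyl G a b c d y) (hsym y) (hdet y hy) (fun _ => rfl) h12 hp htr
    (fun _ _ => rfl) hC⟩
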